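/- Let $(a_n)_{n\ge 0}$ be a sequence of complex numbers such that the power series $g(z)=\sum_{n=0}^{\infty}a_nz^n$ converges for $|z|<1$. Let $(d_k)_{k\ge 1}$ be real numbers for which there are constants $d^-,d^+$ with $0<d^-\le d_k\le d^+$ for all $k\ge 1$, and let the real sequence $(p_j)_{j\ge 0}$ be defined by its generating function $$p(z)=\sum_{j=0}^{\infty}p_jz^j=\exp\Bigl\{\sum_{k=1}^{\infty}\frac{d_k}{k}z^k\Bigr\},\qquad |z|<1$$ (so that $p_j>0$ for all $j$). Then, for every $A\in\mathbb{C}$, the relation $$\lim_{n\to\infty}\frac{1}{p_n}\sum_{k=0}^{n}a_kp_{n-k}=A$$ holds if and only if the following two conditions are both satisfied: 1. $\displaystyle\lim_{x\uparrow 1}g(x)=A$, where $x$ is real; 2. $\displaystyle\sum_{k=0}^{n}k\,a_k\,p_{n-k}=o(np_n)$ as $n\to\infty$. -/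

import Mathlib

open Filter Topology Asymptotics

/-! Let `u n` denote the Voronoi mean. Taking the logarithmic derivative of the generating function
gives n p_n = ∑_{j<n} d_{n-j} p_j, so the numbers d_{n-j} p_j / (n p_n) are transition probabilities
of a descending chain. Convolving the recursion with a shows that condition 2 says exactly that `u`
is almost harmonic for this chain: `u n - average d p u n` → 0. By the Cauchy product, g(x) is the
power mean ∑ p_j u_j x^j / p(x).

If `u` converges, so do its averages and power means, since n p_n and p(x) tend to infinity and
finitely many terms lose their weight.

Conversely, since d lies between positive constants, the law of the first position below L is
comparable with p on [0, L), uniformly in the start (`exists_entrance_law`). Two such laws share a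
fixed fraction of their mass, so the oscillation of `u` contracts
(`norm_sum_sub_le_of_minorization`). Over blocks [K^i, K^(i+1)] with K large, the points below a
block carry little p-mass, the recursion closes, and the block oscillations tend to zero
(`exists_oscillation_bound`). Then `u` varies so slowly that `u n` is close to the power mean at 1 -
x of order 1/n, hence to A (`tendsto_of_tendsto_powerMean`). -/

/-- A positive sequence `p` with `n * p n = ∑ j < n, d (n - j) * p j`, where `d` takes its values
in `[c, C]` on the positive integers and `0 < c`. -/
structure RenewalWeights (d p : ℕ → ℝ) (c C : ℝ) : Prop where
  lower_pos : 0 < c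
  bounds : ∀ k : ℕ, 1 ≤ k → c ≤ d k ∧ d k ≤ C
  zero_pos : 0 < p 0
  recursion : ∀ n : ℕ, (n : ℝ) * p n = ∑ j ∈ Finset.range n, d (n - j) * p j

/-! ### Growth of the weights and their partial sums -/

namespace RenewalWeights

variable {d p : ℕ → ℝ} {c C : ℝ}

theorem upper_pos (h : RenewalWeights d p c C) : 0 < C :=
  h.lower_pos.trans_le ((h.bounds 1 le_rfl).1.trans (h.bounds 1 le_rfl).2)

theorem pos (h : RenewalWeights d p c C) (n : ℕ) : 0 < p n := by
  induction n using Nat.strong_induction_on with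
  | _ n ih =>
    rcases Nat.eq_zero_or_pos n with rfl | hn
    · exact h.zero_pos
    · have h1 : 0 < (n : ℝ) * p n := by
        rw [h.recursion]
        refine Finset.sum_pos (fun j hj => ?_) ⟨0, Finset.mem_range.2 hn⟩
        have hj := Finset.mem_range.1 hj
        exact mul_pos (h.lower_pos.trans_le (h.bounds _ (by omega)).1) (ih j hj)
      exact pos_of_mul_pos_right h1 (Nat.cast_nonneg n)

theorem sum_pos (h : RenewalWeights d p c C) {n : ℕ} (hn : 1 ≤ n) :
    0 < ∑ j ∈ Finset.range n, p j :=
  Finset.sum_pos (fun j _ => h.pos j) ⟨0, Finset.mem_range.2 hn⟩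

theorem sum_mono (h : RenewalWeights d p c C) {m n : ℕ} (hmn : m ≤ n) :
    ∑ j ∈ Finset.range m, p j ≤ ∑ j ∈ Finset.range n, p j :=
  Finset.sum_le_sum_of_subset_of_nonneg (Finset.range_mono hmn) (fun j _ _ => (h.pos j).le)

theorem le_mul (h : RenewalWeights d p c C) (n : ℕ) :
    c * ∑ j ∈ Finset.range n, p j ≤ n * p n := by
  rw [h.recursion, Finset.mul_sum]
  refine Finset.sum_le_sum fun j hj => ?_
  have hj := Finset.mem_range.1 hj
  exact mul_le_mul_of_nonneg_right (h.bounds _ (by omega)).1 (h.pos j).le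

theorem mul_le (h : RenewalWeights d p c C) (n : ℕ) :
    n * p n ≤ C * ∑ j ∈ Finset.range n, p j := by
  rw [h.recursion, Finset.mul_sum]
  refine Finset.sum_le_sum fun j hj => ?_
  have hj := Finset.mem_range.1 hj
  exact mul_le_mul_of_nonneg_right (h.bounds _ (by omega)).2 (h.pos j).le

/-- Each of the L weights on [L, 2L) is at least c S / (2L), where S is the sum below L. -/
theorem sum_doubling (h : RenewalWeights d p c C) {L : ℕ} (hL : 1 ≤ L) :
    (1 + c / 2) * ∑ j ∈ Finset.range L, p j ≤ ∑ j ∈ Finset.range (2 * L), p j := by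
  have hL' : (0 : ℝ) < L := by exact_mod_cast hL
  have hc := h.lower_pos
  set S := ∑ j ∈ Finset.range L, p j with hS
  have hSpos : 0 < S := h.sum_pos hL
  have key : ∀ i ∈ Finset.range L, c * S / (2 * L) ≤ p (L + i) := by
    intro i hi
    have hi := Finset.mem_range.1 hi
    have h1 : c * S ≤ ((L + i : ℕ) : ℝ) * p (L + i) :=
      (mul_le_mul_of_nonneg_left (h.sum_mono (Nat.le_add_right L i)) hc.le).trans
        (h.le_mul (L + i))
    have h2 : ((L + i : ℕ) : ℝ) ≤ 2 * L := by
      have : L + i ≤ 2 * L := by omega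
      exact_mod_cast this
    rw [div_le_iff₀ (by positivity)]
    calc c * S ≤ ((L + i : ℕ) : ℝ) * p (L + i) := h1
      _ ≤ (2 * L) * p (L + i) := mul_le_mul_of_nonneg_right h2 (h.pos _).le
      _ = _ := mul_comm _ _
  have h3 := Finset.sum_le_sum key
  rw [Finset.sum_const, Finset.card_range, nsmul_eq_mul] at h3
  rw [two_mul, Finset.sum_range_add]
  have h4 : (L : ℝ) * (c * S / (2 * L)) = c / 2 * S := by field_simp
  rw [h4] at h3
  linarith

/-- Iterated doubling. It makes the mass below a block negligible against the mass below the end of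
the block, uniformly in L. -/
theorem exists_scale (h : RenewalWeights d p c C) {q : ℝ} (hq : 0 < q) :
    ∃ K : ℕ, 2 ≤ K ∧ ∀ L : ℕ, 1 ≤ L →
      ∑ j ∈ Finset.range L, p j ≤ q * ∑ j ∈ Finset.range (L * K), p j := by
  have hc := h.lower_pos
  have iter : ∀ (t L : ℕ), 1 ≤ L → (1 + c / 2) ^ t * ∑ j ∈ Finset.range L, p j
      ≤ ∑ j ∈ Finset.range (L * 2 ^ t), p j := by
    intro t L hL
    induction t with
    | zero => simp
    | succ t ih =>
      have h1 := h.sum_doubling (L := L * 2 ^ t) (Nat.mul_pos hL (by positivity))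
      have h2 : 2 * (L * 2 ^ t) = L * 2 ^ (t + 1) := by ring
      rw [h2] at h1
      refine le_trans ?_ h1
      rw [pow_succ, mul_comm ((1 + c / 2) ^ t), mul_assoc]
      exact mul_le_mul_of_nonneg_left ih (by positivity)
  obtain ⟨t, ht⟩ := pow_unbounded_of_one_lt q⁻¹ (show 1 < 1 + c / 2 by linarith)
  -- The extra doubling only serves to force K ≥ 2.
  refine ⟨2 ^ (t + 1), by rw [pow_succ]; have := Nat.one_le_two_pow (n := t); omega, ?_⟩
  intro L hL
  have h1 := iter (t + 1) L hL
  have h2 : q⁻¹ ≤ (1 + c / 2) ^ (t + 1) :=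
    ht.le.trans (pow_le_pow_right₀ (by linarith) (Nat.le_succ t))
  have h3 := (mul_le_mul_of_nonneg_right h2 (h.sum_pos hL).le).trans h1
  rwa [inv_mul_le_iff₀ hq] at h3

/-- Beyond L, each new term multiplies the partial sum by at most 1 + C/L ≤ exp (C/L). -/
theorem sum_le_exp_mul (h : RenewalWeights d p c C) {L n K : ℕ} (hL : 1 ≤ L) (hn : n ≤ L * K) :
    ∑ j ∈ Finset.range n, p j ≤ Real.exp (C * K) * ∑ j ∈ Finset.range L, p j := by
  have hC := h.upper_pos
  have hL' : (0 : ℝ) < L := by exact_mod_cast hL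
  have step : ∀ m : ℕ, ∑ j ∈ Finset.range (L + m), p j
      ≤ Real.exp (C * (m / L)) * ∑ j ∈ Finset.range L, p j := by
    intro m
    induction m with
    | zero => simp
    | succ m ih =>
      have hS := h.sum_pos (n := L + m) (by omega)
      have h1 : p (L + m) ≤ C / L * ∑ j ∈ Finset.range (L + m), p j := by
        have h2 := h.mul_le (L + m)
        have h3 : (L : ℝ) * p (L + m) ≤ ((L + m : ℕ) : ℝ) * p (L + m) :=
          mul_le_mul_of_nonneg_right (by push_cast; linarith [(Nat.cast_nonneg m : (0:ℝ) ≤ m)])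
            (h.pos _).le
        rw [div_mul_eq_mul_div, le_div_iff₀ hL', mul_comm]
        exact h3.trans h2
      have h4 : 1 + C / L ≤ Real.exp (C / L) := by
        linarith [Real.add_one_le_exp (C / L)]
      rw [← Nat.add_assoc, Finset.sum_range_succ]
      calc _ ≤ (1 + C / L) * ∑ j ∈ Finset.range (L + m), p j := by linarith
        _ ≤ Real.exp (C / L) *
            (Real.exp (C * (m / L)) * ∑ j ∈ Finset.range L, p j) := by gcongr
        _ = _ := by
          rw [← mul_assoc, ← Real.exp_add]
          congr 2
          push_cast
          field_simp
          ring
  refine (h.sum_mono (show n ≤ L + L * K by omega)).trans ((step (L * K)).trans ?_)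
  have : ((L * K : ℕ) : ℝ) / L = K := by push_cast; field_simp
  rw [this]

/-! ### The descending chain and its entrance laws -/

/-- The averaging operator of the chain jumping from `n` to `j < n` with probability
`d (n - j) * p j / (n * p n)`. -/
noncomputable def average (d p : ℕ → ℝ) (u : ℕ → ℂ) (n : ℕ) : ℂ :=
  ∑ j ∈ Finset.range n, ((d (n - j) * p j / (n * p n) : ℝ) : ℂ) * u j

theorem sum_jump (h : RenewalWeights d p c C) {n : ℕ} (hn : 1 ≤ n) :
    ∑ j ∈ Finset.range n, d (n - j) * p j / (n * p n) = 1 := by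
  have hn' : (0 : ℝ) < n := by exact_mod_cast hn
  rw [← Finset.sum_div, ← h.recursion, div_self (mul_pos hn' (h.pos n)).ne']

theorem jump_nonneg (h : RenewalWeights d p c C) {n j : ℕ} (hj : j < n) :
    0 ≤ d (n - j) * p j / (n * p n) :=
  div_nonneg (mul_nonneg (h.lower_pos.le.trans (h.bounds _ (by omega)).1) (h.pos j).le)
    (mul_nonneg (Nat.cast_nonneg n) (h.pos n).le)

/-- Wherever the chain starts above `L`, the law of its first position below `L` is comparable
with the normalised weights `p` on `[0, L)`. -/
theorem exists_entrance_law (h : RenewalWeights d p c C) {κ ε T : ℝ} (hκ : 0 < κ)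
    (hκC : κ * C ≤ c) (hε : 0 ≤ ε) {L N : ℕ} (hL : 1 ≤ L)
    (hT : ∀ n, L ≤ n → n ≤ N → (n : ℝ) * p n ≤ T * (c * ∑ a ∈ Finset.range L, p a))
    (u : ℕ → ℂ) (hu : ∀ n, L ≤ n → n ≤ N → ‖u n - average d p u n‖ ≤ ε)
    (n : ℕ) (hLn : L ≤ n) (hnN : n ≤ N) :
    ∃ ν : ℕ → ℝ,
      (∀ a, a < L → κ * p a ≤ (∑ a ∈ Finset.range L, p a) * ν a ∧
        κ * ((∑ a ∈ Finset.range L, p a) * ν a) ≤ p a) ∧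
      ∑ a ∈ Finset.range L, ν a = 1 ∧
      ‖u n - ∑ a ∈ Finset.range L, (ν a : ℂ) * u a‖ ≤ ε * T := by
  induction n using Nat.strong_induction_on with
  | _ n ih =>
  have hc := h.lower_pos
  have hC := h.upper_pos
  set S := ∑ a ∈ Finset.range L, p a with hS
  have hSpos : 0 < S := h.sum_pos hL
  -- The membership condition is moved under the existential so that `choose` yields a total family;
  -- the value 0 outside the interval is never used.
  have ih' : ∀ m, ∃ ν : ℕ → ℝ, m ∈ Finset.Ico L n →
      (∀ a, a < L → κ * p a ≤ S * ν a ∧ κ * (S * ν a) ≤ p a) ∧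
      ∑ a ∈ Finset.range L, ν a = 1 ∧
      ‖u m - ∑ a ∈ Finset.range L, (ν a : ℂ) * u a‖ ≤ ε * T := by
    intro m
    by_cases hm : m ∈ Finset.Ico L n
    · have hm' := Finset.mem_Ico.1 hm
      obtain ⟨ν, hν⟩ := ih m hm'.2 hm'.1 (by omega)
      exact ⟨ν, fun _ => hν⟩
    · exact ⟨0, fun hm' => absurd hm' hm⟩
  choose ν hν using ih'
  have hn1 : 1 ≤ n := hL.trans hLn
  have hnp : 0 < (n : ℝ) * p n := mul_pos (by exact_mod_cast hn1) (h.pos n)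
  set w : ℕ → ℝ := fun j => d (n - j) * p j / (n * p n) with hw
  have hw0 : ∀ j, j < n → 0 ≤ w j := fun j hj => h.jump_nonneg hj
  have hw1 : ∑ j ∈ Finset.range L, w j + ∑ j ∈ Finset.Ico L n, w j = 1 := by
    rw [Finset.sum_range_add_sum_Ico _ hLn]
    exact h.sum_jump hn1
  set s := ∑ j ∈ Finset.range L, w j with hs
  have hs_ge : c * S ≤ (n * p n) * s := by
    rw [hs, hS, Finset.mul_sum, Finset.mul_sum]
    refine Finset.sum_le_sum fun j hj => ?_
    have hj := Finset.mem_range.1 hj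
    rw [hw]
    simp only
    rw [mul_div_cancel₀ _ hnp.ne']
    exact mul_le_mul_of_nonneg_right (h.bounds _ (by omega)).1 (h.pos j).le
  have hs_le : (n * p n) * s ≤ C * S := by
    rw [hs, hS, Finset.mul_sum, Finset.mul_sum]
    refine Finset.sum_le_sum fun j hj => ?_
    have hj := Finset.mem_range.1 hj
    rw [hw]
    simp only
    rw [mul_div_cancel₀ _ hnp.ne']
    exact mul_le_mul_of_nonneg_right (h.bounds _ (by omega)).2 (h.pos j).le
  have hwp : ∀ a, a < L → (n * p n) * w a = d (n - a) * p a := by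
    intro a _
    rw [hw]
    simp only
    rw [mul_div_cancel₀ _ hnp.ne']
  -- A direct jump below L lands at a with conditional probability w a / s, whose ratio to p a / S
  -- lies between κ and 1/κ.
  have hwlow : ∀ a, a < L → κ * p a * s ≤ S * w a := by
    intro a ha
    have h1 := (h.bounds (n - a) (by omega)).1
    refine le_of_mul_le_mul_left ?_ hnp
    calc (n * p n) * (κ * p a * s) = κ * p a * ((n * p n) * s) := by ring
      _ ≤ κ * p a * (C * S) :=
        mul_le_mul_of_nonneg_left hs_le (mul_nonneg hκ.le (h.pos a).le)
      _ = (κ * C) * (S * p a) := by ring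
      _ ≤ d (n - a) * (S * p a) :=
        mul_le_mul_of_nonneg_right (hκC.trans h1) (mul_nonneg hSpos.le (h.pos a).le)
      _ = (n * p n) * (S * w a) := by
        linear_combination (-S) * hwp a ha
  have hwup : ∀ a, a < L → κ * (S * w a) ≤ p a * s := by
    intro a ha
    have h1 := (h.bounds (n - a) (by omega)).2
    refine le_of_mul_le_mul_left ?_ hnp
    calc (n * p n) * (κ * (S * w a)) = κ * S * ((n * p n) * w a) := by ring
      _ = κ * S * (d (n - a) * p a) := by rw [hwp a ha]
      _ ≤ κ * S * (C * p a) :=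
        mul_le_mul_of_nonneg_left (mul_le_mul_of_nonneg_right h1 (h.pos a).le)
          (mul_nonneg hκ.le hSpos.le)
      _ = (κ * C) * (S * p a) := by ring
      _ ≤ c * (S * p a) :=
        mul_le_mul_of_nonneg_right hκC (mul_nonneg hSpos.le (h.pos a).le)
      _ = p a * (c * S) := by ring
      _ ≤ p a * ((n * p n) * s) := mul_le_mul_of_nonneg_left hs_ge (h.pos a).le
      _ = _ := by ring
  -- First-step decomposition: the chain either enters [0, L) at a immediately, or lands at some j ≥
  -- L and continues with the law already built for j.
  refine ⟨fun a => w a + ∑ j ∈ Finset.Ico L n, w j * ν j a, ?_, ?_, ?_⟩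
  · intro a ha
    constructor
    · have h2 : ∑ j ∈ Finset.Ico L n, w j * (κ * p a)
          ≤ ∑ j ∈ Finset.Ico L n, w j * (S * ν j a) :=
        Finset.sum_le_sum fun j hj => mul_le_mul_of_nonneg_left ((hν j hj).1 a ha).1
          (hw0 j (Finset.mem_Ico.1 hj).2)
      rw [← Finset.sum_mul] at h2
      have h3 : S * (w a + ∑ j ∈ Finset.Ico L n, w j * ν j a)
          = S * w a + ∑ j ∈ Finset.Ico L n, w j * (S * ν j a) := by
        rw [mul_add, Finset.mul_sum]
        congr 1
        exact Finset.sum_congr rfl fun j _ => by ring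
      rw [h3]
      have h4 : ∑ j ∈ Finset.Ico L n, w j = 1 - s := by linarith
      rw [h4] at h2
      linarith [hwlow a ha]
    · have h2 : ∑ j ∈ Finset.Ico L n, w j * (κ * (S * ν j a))
          ≤ ∑ j ∈ Finset.Ico L n, w j * p a :=
        Finset.sum_le_sum fun j hj => mul_le_mul_of_nonneg_left ((hν j hj).1 a ha).2
          (hw0 j (Finset.mem_Ico.1 hj).2)
      rw [← Finset.sum_mul] at h2
      have h3 : κ * (S * (w a + ∑ j ∈ Finset.Ico L n, w j * ν j a))
          = κ * (S * w a) + ∑ j ∈ Finset.Ico L n, w j * (κ * (S * ν j a)) := by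
        rw [mul_add, mul_add, Finset.mul_sum, Finset.mul_sum]
        congr 1
        exact Finset.sum_congr rfl fun j _ => by ring
      rw [h3]
      have h4 : ∑ j ∈ Finset.Ico L n, w j = 1 - s := by linarith
      rw [h4] at h2
      linarith [hwup a ha]
  · rw [Finset.sum_add_distrib, Finset.sum_comm, ← hw1]
    congr 1
    refine Finset.sum_congr rfl fun j hj => ?_
    rw [← Finset.mul_sum, (hν j hj).2.1, mul_one]
  · have e1 : average d p u n = ∑ a ∈ Finset.range L, (w a : ℂ) * u a
        + ∑ j ∈ Finset.Ico L n, (w j : ℂ) * u j :=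
      (Finset.sum_range_add_sum_Ico _ hLn).symm
    have e2 : ∑ a ∈ Finset.range L, ((w a + ∑ j ∈ Finset.Ico L n, w j * ν j a : ℝ) : ℂ) * u a
        = ∑ a ∈ Finset.range L, (w a : ℂ) * u a
          + ∑ j ∈ Finset.Ico L n, (w j : ℂ) * ∑ a ∈ Finset.range L, (ν j a : ℂ) * u a := by
      simp_rw [Finset.mul_sum]
      rw [Finset.sum_comm, ← Finset.sum_add_distrib]
      refine Finset.sum_congr rfl fun a _ => ?_
      push_cast
      rw [add_mul, Finset.sum_mul]
      congr 1
      exact Finset.sum_congr rfl fun j _ => by ring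
    have e3 : u n - ∑ a ∈ Finset.range L,
          ((w a + ∑ j ∈ Finset.Ico L n, w j * ν j a : ℝ) : ℂ) * u a
        = (u n - average d p u n) + ∑ j ∈ Finset.Ico L n,
          (w j : ℂ) * (u j - ∑ a ∈ Finset.range L, (ν j a : ℂ) * u a) := by
      rw [e2, e1]
      simp_rw [mul_sub]
      rw [Finset.sum_sub_distrib]
      ring
    have h5 : ‖∑ j ∈ Finset.Ico L n,
        (w j : ℂ) * (u j - ∑ a ∈ Finset.range L, (ν j a : ℂ) * u a)‖ ≤ (1 - s) * (ε * T) := by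
      have h4 : ∑ j ∈ Finset.Ico L n, w j = 1 - s := by linarith
      rw [← h4, Finset.sum_mul]
      refine norm_sum_le_of_le _ fun j hj => ?_
      rw [norm_mul, Complex.norm_real, Real.norm_of_nonneg (hw0 j (Finset.mem_Ico.1 hj).2)]
      exact mul_le_mul_of_nonneg_left (hν j hj).2.2 (hw0 j (Finset.mem_Ico.1 hj).2)
    -- The chance s of entering at each step is at least 1/T, so errors of size ε accumulate to at
    -- most ε T.
    have h6 : 1 ≤ T * s := by
      have h7 := hT n hLn hnN
      have hTpos : 0 ≤ T := by
        by_contra hneg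
        have : T * (c * S) < 0 := mul_neg_of_neg_of_pos (not_le.1 hneg) (mul_pos hc hSpos)
        linarith
      have h8 : n * p n * 1 ≤ n * p n * (T * s) := by
        calc n * p n * 1 ≤ T * (c * S) := by linarith
          _ ≤ T * ((n * p n) * s) := mul_le_mul_of_nonneg_left hs_ge hTpos
          _ = _ := by ring
      exact le_of_mul_le_mul_left h8 hnp
    rw [e3]
    calc _ ≤ ε + (1 - s) * (ε * T) :=
          (norm_add_le _ _).trans (add_le_add (hu n hLn hnN) h5)
      _ = ε * T + ε * (1 - T * s) := by ring
      _ ≤ ε * T := by nlinarith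

end RenewalWeights

/-! ### Contraction of oscillation -/

/-- Doeblin contraction for two probability weights that dominate `κ * μ` and are dominated by
`μ / κ`, where `φ` controls the excess over `D` of the oscillation of `u`. -/
theorem norm_sum_sub_le_of_minorization {ι : Type*} (s : Finset ι) {μ ν ν' φ : ι → ℝ} {u : ι → ℂ}
    {κ D Y : ℝ} (hκ : 0 < κ) (hκ1 : κ < 1) (hμ1 : ∑ a ∈ s, μ a = 1)
    (hν : ∀ a ∈ s, κ * μ a ≤ ν a ∧ κ * ν a ≤ μ a) (hν1 : ∑ a ∈ s, ν a = 1)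
    (hν' : ∀ a ∈ s, κ * μ a ≤ ν' a ∧ κ * ν' a ≤ μ a) (hν'1 : ∑ a ∈ s, ν' a = 1)
    (hμ : ∀ a ∈ s, 0 ≤ μ a) (hφ : ∀ a ∈ s, 0 ≤ φ a) (hY : ∑ a ∈ s, μ a * φ a ≤ Y)
    (hu : ∀ a ∈ s, ∀ b ∈ s, ‖u a - u b‖ ≤ D + φ a + φ b) :
    ‖∑ a ∈ s, (ν a : ℂ) * u a - ∑ a ∈ s, (ν' a : ℂ) * u a‖ ≤ (1 - κ) * D + 2 / κ * Y := by
  -- The common part κ μ cancels in the difference; the remainders α and β both have mass 1 - κ and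
  -- are coupled by their product.
  set α : ι → ℝ := fun a => ν a - κ * μ a with hα
  set β : ι → ℝ := fun a => ν' a - κ * μ a with hβ
  have hα0 : ∀ a ∈ s, 0 ≤ α a := fun a ha => sub_nonneg.2 (hν a ha).1
  have hβ0 : ∀ a ∈ s, 0 ≤ β a := fun a ha => sub_nonneg.2 (hν' a ha).1
  have hα1 : ∑ a ∈ s, α a = 1 - κ := by
    rw [hα, Finset.sum_sub_distrib, ← Finset.mul_sum, hν1, hμ1, mul_one]
  have hβ1 : ∑ a ∈ s, β a = 1 - κ := by
    rw [hβ, Finset.sum_sub_distrib, ← Finset.mul_sum, hν'1, hμ1, mul_one]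
  have hφsum : ∀ (ρ : ι → ℝ), (∀ a ∈ s, κ * ρ a ≤ μ a) →
      ∑ a ∈ s, (ρ a - κ * μ a) * φ a ≤ Y / κ := by
    intro ρ hρ
    rw [le_div_iff₀ hκ, Finset.sum_mul]
    refine le_trans (Finset.sum_le_sum fun a ha => ?_) hY
    have h1 := mul_le_mul_of_nonneg_right (hρ a ha) (hφ a ha)
    have h2 : 0 ≤ κ * (κ * (μ a * φ a)) :=
      mul_nonneg hκ.le (mul_nonneg hκ.le (mul_nonneg (hμ a ha) (hφ a ha)))
    nlinarith
  have hαφ : ∑ a ∈ s, α a * φ a ≤ Y / κ := hφsum ν fun a ha => (hν a ha).2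
  have hβφ : ∑ a ∈ s, β a * φ a ≤ Y / κ := hφsum ν' fun a ha => (hν' a ha).2
  have hα1' : ∑ a ∈ s, (α a : ℂ) = ((1 - κ : ℝ) : ℂ) := by rw [← hα1]; push_cast; rfl
  have hβ1' : ∑ a ∈ s, (β a : ℂ) = ((1 - κ : ℝ) : ℂ) := by rw [← hβ1]; push_cast; rfl
  have e1 : ((1 - κ : ℝ) : ℂ) * (∑ a ∈ s, (ν a : ℂ) * u a - ∑ a ∈ s, (ν' a : ℂ) * u a)
      = ∑ a ∈ s, ∑ b ∈ s, ((α a * β b : ℝ) : ℂ) * (u a - u b) := by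
    have e2 : ∑ a ∈ s, (ν a : ℂ) * u a - ∑ a ∈ s, (ν' a : ℂ) * u a
        = ∑ a ∈ s, (α a : ℂ) * u a - ∑ a ∈ s, (β a : ℂ) * u a := by
      rw [← Finset.sum_sub_distrib, ← Finset.sum_sub_distrib]
      refine Finset.sum_congr rfl fun a _ => ?_
      simp only [hα, hβ]
      push_cast
      ring
    have e3 : ∑ a ∈ s, ∑ b ∈ s, ((α a * β b : ℝ) : ℂ) * (u a - u b)
        = (∑ a ∈ s, (α a : ℂ) * u a) * ∑ b ∈ s, (β b : ℂ)
          - (∑ a ∈ s, (α a : ℂ)) * ∑ b ∈ s, (β b : ℂ) * u b := by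
      rw [Finset.sum_mul_sum, Finset.sum_mul_sum, ← Finset.sum_sub_distrib]
      refine Finset.sum_congr rfl fun a _ => ?_
      rw [← Finset.sum_sub_distrib]
      refine Finset.sum_congr rfl fun b _ => ?_
      push_cast
      ring
    rw [e3, hα1', hβ1', e2]
    ring
  have h1 : ‖∑ a ∈ s, ∑ b ∈ s, ((α a * β b : ℝ) : ℂ) * (u a - u b)‖
      ≤ ∑ a ∈ s, ∑ b ∈ s, α a * β b * (D + φ a + φ b) := by
    refine norm_sum_le_of_le _ fun a ha => norm_sum_le_of_le _ fun b hb => ?_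
    have h2 := mul_nonneg (hα0 a ha) (hβ0 b hb)
    rw [norm_mul, Complex.norm_real, Real.norm_of_nonneg h2]
    exact mul_le_mul_of_nonneg_left (hu a ha b hb) h2
  have e4 : ∑ a ∈ s, ∑ b ∈ s, α a * β b * (D + φ a + φ b)
      = (∑ a ∈ s, α a) * (∑ b ∈ s, β b) * D + (∑ a ∈ s, α a * φ a) * (∑ b ∈ s, β b)
        + (∑ a ∈ s, α a) * ∑ b ∈ s, β b * φ b := by
    rw [Finset.sum_mul_sum, Finset.sum_mul_sum, Finset.sum_mul_sum, Finset.sum_mul,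
      ← Finset.sum_add_distrib, ← Finset.sum_add_distrib]
    refine Finset.sum_congr rfl fun a _ => ?_
    rw [Finset.sum_mul, ← Finset.sum_add_distrib, ← Finset.sum_add_distrib]
    exact Finset.sum_congr rfl fun b _ => by ring
  rw [e4, hα1, hβ1, ← e1, norm_mul, Complex.norm_real,
    Real.norm_of_nonneg (by linarith : (0 : ℝ) ≤ 1 - κ)] at h1
  have hpos : 0 < 1 - κ := by linarith
  refine le_of_mul_le_mul_left (h1.trans ?_) hpos
  have h5 := mul_le_mul_of_nonneg_left hαφ hpos.le
  have h6 := mul_le_mul_of_nonneg_left hβφ hpos.le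
  have e5 : (1 - κ) * ((1 - κ) * D + 2 / κ * Y)
      = (1 - κ) * (1 - κ) * D + (1 - κ) * (Y / κ) + (1 - κ) * (Y / κ) := by ring
  rw [e5]
  linarith

theorem tendsto_zero_of_le_mul_add {X η : ℕ → ℝ} {ρ : ℝ} (hρ0 : 0 ≤ ρ) (hρ1 : ρ < 1)
    (hX : ∀ i, 0 ≤ X i) (hη : Tendsto η atTop (𝓝 0)) (h : ∀ i, X (i + 1) ≤ ρ * X i + η i) :
    Tendsto X atTop (𝓝 0) := by
  rw [Metric.tendsto_atTop]
  intro ε hε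
  have hpos : 0 < (1 - ρ) * (ε / 2) := mul_pos (by linarith) (by linarith)
  obtain ⟨N, hN⟩ := eventually_atTop.1 (hη.eventually (eventually_le_nhds hpos))
  -- With η ≤ (1 - ρ) ε/2 the value ε/2 is fixed by x ↦ ρ x + (1 - ρ) ε/2.
  have iter : ∀ k, X (N + k) ≤ ρ ^ k * X N + ε / 2 := by
    intro k
    induction k with
    | zero => simp; linarith
    | succ k ih =>
      have h1 := h (N + k)
      have h2 := hN (N + k) (by omega)
      have h3 := mul_le_mul_of_nonneg_left ih hρ0
      rw [← Nat.add_assoc, pow_succ]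
      nlinarith
  have hlim : Tendsto (fun k => ρ ^ k * X N) atTop (𝓝 0) := by
    simpa using (tendsto_pow_atTop_nhds_zero_of_lt_one hρ0 hρ1).mul_const (X N)
  obtain ⟨k₀, hk₀⟩ := eventually_atTop.1 (hlim.eventually (eventually_lt_nhds (half_pos hε)))
  refine ⟨N + k₀, fun n hn => ?_⟩
  have h1 := iter (n - N)
  have h2 := hk₀ (n - N) (by omega)
  rw [show N + (n - N) = n by omega] at h1
  rw [Real.dist_eq, sub_zero, abs_of_nonneg (hX n)]
  linarith

/-! ### Oscillation over geometric blocks -/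

namespace RenewalWeights

variable {d p : ℕ → ℝ} {c C : ℝ}

/-- One contraction step: the oscillation of an almost harmonic `u` on `[L, L * K]` in terms of
its oscillation on `[0, L]`. -/
theorem norm_sub_le_of_scale (h : RenewalWeights d p c C) {κ ε D Y : ℝ} (hκ : 0 < κ) (hκ1 : κ < 1)
    (hκC : κ * C ≤ c) (hε : 0 ≤ ε) {L K : ℕ} (hL : 1 ≤ L) {u : ℕ → ℂ} {φ : ℕ → ℝ}
    (hu : ∀ n, L ≤ n → n ≤ L * K → ‖u n - average d p u n‖ ≤ ε)
    (hφ : ∀ a, 0 ≤ φ a)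
    (hY : ∑ a ∈ Finset.range L, p a * φ a ≤ (∑ a ∈ Finset.range L, p a) * Y)
    (hosc : ∀ a b, a ≤ L → b ≤ L → ‖u a - u b‖ ≤ D + φ a + φ b)
    {m n : ℕ} (hm : L ≤ m) (hmK : m ≤ L * K) (hn : L ≤ n) (hnK : n ≤ L * K) :
    ‖u m - u n‖ ≤ 2 * (C * Real.exp (C * K) / c) * ε + (1 - κ) * D + 2 / κ * Y := by
  have hc := h.lower_pos
  have hC := h.upper_pos
  set S := ∑ a ∈ Finset.range L, p a with hS
  have hSpos : 0 < S := h.sum_pos hL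
  -- From n p_n ≤ C ∑_{j<n} p_j and the exponential growth bound on [L, LK].
  set T := C * Real.exp (C * K) / c with hT
  have hTn : ∀ n, L ≤ n → n ≤ L * K → (n : ℝ) * p n ≤ T * (c * S) := by
    intro n _ hnK
    refine (h.mul_le n).trans ?_
    have h1 := mul_le_mul_of_nonneg_left (h.sum_le_exp_mul hL hnK) hC.le
    refine h1.trans (le_of_eq ?_)
    rw [hT, ← hS]
    field_simp
  obtain ⟨ν, hν, hν1, hνu⟩ := h.exists_entrance_law hκ hκC hε hL hTn u hu m hm hmK
  obtain ⟨ν', hν', hν'1, hν'u⟩ := h.exists_entrance_law hκ hκC hε hL hTn u hu n hn hnK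
  have conv : ∀ ρ : ℕ → ℝ, (∀ a, a < L → κ * p a ≤ S * ρ a ∧ κ * (S * ρ a) ≤ p a) →
      ∀ a ∈ Finset.range L, κ * (p a / S) ≤ ρ a ∧ κ * ρ a ≤ p a / S := by
    intro ρ hρ a ha
    obtain ⟨h1, h2⟩ := hρ a (Finset.mem_range.1 ha)
    constructor
    · rw [← mul_div_assoc, div_le_iff₀ hSpos]; linarith
    · rw [le_div_iff₀ hSpos]; linarith
  have key := norm_sum_sub_le_of_minorization (Finset.range L) (μ := fun a => p a / S) (ν := ν)
    (ν' := ν') (φ := φ) (u := u) (D := D) (Y := Y) hκ hκ1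
    (by rw [← Finset.sum_div, div_self hSpos.ne']) (conv ν hν) hν1 (conv ν' hν') hν'1
    (fun a _ => div_nonneg (h.pos a).le hSpos.le) (fun a _ => hφ a)
    (by
      have e : ∑ a ∈ Finset.range L, p a / S * φ a
          = (∑ a ∈ Finset.range L, p a * φ a) / S := by
        rw [Finset.sum_div]
        exact Finset.sum_congr rfl fun a _ => by ring
      rw [e, div_le_iff₀ hSpos]
      linarith)
    (fun a ha b hb => hosc a b (Finset.mem_range.1 ha).le (Finset.mem_range.1 hb).le)
  set x := ∑ a ∈ Finset.range L, (ν a : ℂ) * u a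
  set y := ∑ a ∈ Finset.range L, (ν' a : ℂ) * u a
  have e : u m - u n = (u m - x) + (x - y) - (u n - y) := by ring
  rw [e]
  have h1 := norm_sub_le ((u m - x) + (x - y)) (u n - y)
  have h2 := norm_add_le (u m - x) (x - y)
  linarith

/-- The oscillation of an almost harmonic `u` over the blocks `[K ^ i, K ^ (i + 1)]` tends to
zero; `φ i` accounts for the points below the block. -/
theorem exists_oscillation_bound (h : RenewalWeights d p c C) {u : ℕ → ℂ}
    (hu : Tendsto (fun n => u n - average d p u n) atTop (𝓝 0)) :
    ∃ (K : ℕ) (D Y : ℕ → ℝ) (φ : ℕ → ℕ → ℝ), 2 ≤ K ∧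
      Tendsto D atTop (𝓝 0) ∧ Tendsto Y atTop (𝓝 0) ∧
      (∀ i a, 0 ≤ φ i a) ∧ (∀ i a, K ^ i ≤ a → φ i a = 0) ∧
      (∀ i, ∑ a ∈ Finset.range (K ^ (i + 1)), p a * φ i a
        ≤ (∑ a ∈ Finset.range (K ^ (i + 1)), p a) * Y i) ∧
      (∀ i a b, a ≤ K ^ (i + 1) → b ≤ K ^ (i + 1) → ‖u a - u b‖ ≤ D i + φ i a + φ i b) := by
  have hc := h.lower_pos
  have hC := h.upper_pos
  have hcC : c ≤ C := (h.bounds 1 le_rfl).1.trans (h.bounds 1 le_rfl).2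
  obtain ⟨κ, hκ, hκ2, hκC⟩ : ∃ κ : ℝ, 0 < κ ∧ κ ≤ 1 / 2 ∧ κ * C ≤ c := by
    refine ⟨c / (2 * C), by positivity, ?_, ?_⟩
    · rw [div_le_iff₀ (by positivity)]; linarith
    · rw [div_mul_eq_mul_div, div_le_iff₀ (by positivity)]; nlinarith
  -- Chosen so that (4/κ) q = κ/2 in the Lyapunov estimate for `D` and `Y` below.
  set q := κ ^ 2 / 8 with hq
  have hqpos : 0 < q := by positivity
  obtain ⟨K, hK2, hKq⟩ := h.exists_scale hqpos
  set T := C * Real.exp (C * K) / c with hT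
  have hTpos : 0 < T := by positivity
  set e : ℕ → ℂ := fun n => u n - average d p u n with he
  set η : ℕ → ℝ := fun i =>
    ((Finset.Icc (K ^ (i + 1)) (K ^ (i + 1) * K)).sup fun n => ‖e n‖₊ : NNReal) with hη
  have hηle : ∀ i n, K ^ (i + 1) ≤ n → n ≤ K ^ (i + 1) * K → ‖e n‖ ≤ η i := by
    intro i n h1 h2
    have := Finset.le_sup (f := fun n => ‖e n‖₊) (Finset.mem_Icc.2 ⟨h1, h2⟩)
    exact_mod_cast this
  have hη0 : ∀ i, 0 ≤ η i := fun i => NNReal.coe_nonneg _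
  have hηlim : Tendsto η atTop (𝓝 0) := by
    rw [Metric.tendsto_atTop]
    intro ε hε
    rw [Metric.tendsto_atTop] at hu
    obtain ⟨N, hN⟩ := hu (ε / 2) (half_pos hε)
    refine ⟨N, fun i hi => ?_⟩
    rw [Real.dist_eq, sub_zero, abs_of_nonneg (hη0 i)]
    refine lt_of_le_of_lt ?_ (half_lt_self hε)
    have : (Finset.Icc (K ^ (i + 1)) (K ^ (i + 1) * K)).sup (fun n => ‖e n‖₊)
        ≤ (⟨ε / 2, (half_pos hε).le⟩ : NNReal) := by
      refine Finset.sup_le fun n hn => ?_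
      have h1 := (Finset.mem_Icc.1 hn).1
      have h2 : i + 1 < K ^ (i + 1) := Nat.lt_pow_self (by omega)
      have h3 := hN n (by omega)
      rw [dist_zero_right] at h3
      exact_mod_cast h3.le
    exact_mod_cast this
  -- The pair (D, Y): D follows the one-block contraction. Y bounds the mean of φ; points below the
  -- next block have relative mass at most q, whence q (D + Y).
  let R : ℕ → ℝ × ℝ := fun i => Nat.rec (2 * ∑ j ∈ Finset.range (K + 1), ‖u j‖, 0)
    (fun i r => (2 * T * η i + (1 - κ) * r.1 + 2 / κ * r.2, q * (r.1 + r.2))) i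
  let D : ℕ → ℝ := fun i => (R i).1
  let Y : ℕ → ℝ := fun i => (R i).2
  have hD0 : D 0 = 2 * ∑ j ∈ Finset.range (K + 1), ‖u j‖ := rfl
  have hY0 : Y 0 = 0 := rfl
  have hDs : ∀ i, D (i + 1) = 2 * T * η i + (1 - κ) * D i + 2 / κ * Y i := fun i => rfl
  have hYs : ∀ i, Y (i + 1) = q * (D i + Y i) := fun i => rfl
  -- The cost of moving a point below the new block up to its left end K^(i+1), by the preceding
  -- oscillation bound.
  let φ : ℕ → ℕ → ℝ := fun i => Nat.rec (fun _ => 0)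
    (fun i f a => if a < K ^ (i + 1) then f a + D i else 0) i
  have hφ0 : ∀ a, φ 0 a = 0 := fun a => rfl
  have hφs : ∀ i a, φ (i + 1) a = if a < K ^ (i + 1) then φ i a + D i else 0 := fun i a => rfl
  clear_value D Y φ
  have hDY : ∀ i, 0 ≤ D i ∧ 0 ≤ Y i := by
    intro i
    induction i with
    | zero => rw [hD0, hY0]; exact ⟨by positivity, le_rfl⟩
    | succ i ih =>
      obtain ⟨h1, h2⟩ := ih
      have h3 := hη0 i
      have h4 : 0 ≤ 1 - κ := by linarith
      rw [hDs, hYs]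
      exact ⟨by positivity, by positivity⟩
  have hφnn : ∀ i a, 0 ≤ φ i a := by
    intro i
    induction i with
    | zero => intro a; rw [hφ0]
    | succ i ih =>
      intro a
      rw [hφs]
      split_ifs
      · exact add_nonneg (ih a) (hDY i).1
      · exact le_rfl
  have hφz : ∀ i a, K ^ i ≤ a → φ i a = 0 := by
    intro i a ha
    cases i with
    | zero => exact hφ0 a
    | succ i => rw [hφs, if_neg (by omega)]
  have hKpos : ∀ i, 1 ≤ K ^ i := fun i => Nat.one_le_pow _ _ (by omega)
  have hKmono : ∀ i, K ^ (i + 1) ≤ K ^ (i + 1 + 1) := fun i =>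
    Nat.pow_le_pow_right (by omega) (Nat.le_succ _)
  have hsum : ∀ i, ∑ a ∈ Finset.range (K ^ (i + 1)), p a * φ i a
      ≤ (∑ a ∈ Finset.range (K ^ (i + 1)), p a) * Y i := by
    intro i
    induction i with
    | zero => simp [hφ0, hY0]
    | succ i ih =>
      have h1 : ∑ a ∈ Finset.range (K ^ (i + 1 + 1)), p a * φ (i + 1) a
          = ∑ a ∈ Finset.range (K ^ (i + 1)), p a * (φ i a + D i) := by
        rw [← Finset.sum_subset (Finset.range_mono (hKmono i))]
        · refine Finset.sum_congr rfl fun a ha => ?_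
          rw [hφs, if_pos (Finset.mem_range.1 ha)]
        · intro a _ ha
          rw [hφs, if_neg (fun h' => ha (Finset.mem_range.2 h')), mul_zero]
      have h2 := hKq (K ^ (i + 1)) (hKpos _)
      rw [← pow_succ] at h2
      have h3 := mul_le_mul_of_nonneg_right h2 (add_nonneg (hDY i).1 (hDY i).2)
      rw [h1, hYs]
      simp_rw [mul_add]
      rw [Finset.sum_add_distrib, ← Finset.sum_mul]
      linarith
  have hosc : ∀ i a b, a ≤ K ^ (i + 1) → b ≤ K ^ (i + 1) →
      ‖u a - u b‖ ≤ D i + φ i a + φ i b := by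
    intro i
    induction i with
    | zero =>
      intro a b ha hb
      rw [hφ0, hφ0, hD0, add_zero, add_zero]
      have hle : ∀ a, a ≤ K ^ (0 + 1) → ‖u a‖ ≤ ∑ j ∈ Finset.range (K + 1), ‖u j‖ := by
        intro a ha
        rw [zero_add, pow_one] at ha
        exact Finset.single_le_sum (f := fun j => ‖u j‖) (fun j _ => norm_nonneg _)
          (Finset.mem_range.2 (by omega))
      linarith [norm_sub_le (u a) (u b), hle a ha, hle b hb]
    | succ i ih =>
      intro a b ha hb
      have up : ∀ a, ‖u a - u (max a (K ^ (i + 1)))‖ ≤ φ (i + 1) a := by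
        intro a
        rw [hφs]
        split_ifs with hlt
        · rw [max_eq_right hlt.le]
          have h1 := ih a (K ^ (i + 1)) hlt.le le_rfl
          rw [hφz i (K ^ (i + 1)) (Nat.pow_le_pow_right (by omega) (Nat.le_succ i))] at h1
          linarith
        · rw [max_eq_left (not_lt.1 hlt), sub_self, norm_zero]
      have h2 := h.norm_sub_le_of_scale (K := K) hκ (by linarith) hκC (hη0 i) (hKpos (i + 1))
        (hηle i) (hφnn i) (hsum i) ih (m := max a (K ^ (i + 1))) (n := max b (K ^ (i + 1)))
        (le_max_right _ _) (by rw [← pow_succ]; exact max_le ha (hKmono i))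
        (le_max_right _ _) (by rw [← pow_succ]; exact max_le hb (hKmono i))
      rw [← hT, ← hDs] at h2
      have h3 := up a
      have h4 := up b
      rw [norm_sub_rev] at h4
      set a' := max a (K ^ (i + 1))
      set b' := max b (K ^ (i + 1))
      have e : u a - u b = (u a - u a') + (u a' - u b') + (u b' - u b) := by ring
      rw [e]
      have h5 := norm_add₃_le (a := u a - u a') (b := u a' - u b') (c := u b' - u b)
      linarith
  -- The combination D + (4/κ) Y contracts by 1 - κ/2, up to the defect 2 T η; κ ≤ 1/2 leaves room
  -- for the coefficient of Y.
  have hX : Tendsto (fun i => D i + 4 / κ * Y i) atTop (𝓝 0) := by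
    refine tendsto_zero_of_le_mul_add (ρ := 1 - κ / 2) (η := fun i => 2 * T * η i)
      (by linarith) (by linarith) (fun i => ?_) ?_ (fun i => ?_)
    · have := hDY i
      exact add_nonneg this.1 (mul_nonneg (by positivity) this.2)
    · simpa using hηlim.const_mul (2 * T)
    · rw [hDs, hYs]
      obtain ⟨h1, h2⟩ := hDY i
      have e1 : 4 / κ * (q * (D i + Y i)) = κ / 2 * (D i + Y i) := by
        rw [hq]; field_simp; ring
      have h3 : κ / 2 * Y i ≤ 2 / κ * Y i * (1 - κ) := by
        have : κ / 2 ≤ 2 / κ * (1 - κ) := by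
          rw [div_mul_eq_mul_div, le_div_iff₀ hκ]
          nlinarith
        nlinarith
      have e2 : (1 - κ / 2) * (D i + 4 / κ * Y i) = (1 - κ / 2) * D i + 2 / κ * Y i
          + 2 / κ * Y i * (1 - κ) := by ring
      rw [e1, e2]
      linarith
  refine ⟨K, D, Y, φ, hK2, ?_, ?_, hφnn, hφz, hsum, hosc⟩
  · refine squeeze_zero (fun i => (hDY i).1) (fun i => ?_) hX
    have := mul_nonneg (by positivity : 0 ≤ 4 / κ) (hDY i).2
    linarith
  · refine squeeze_zero (fun i => (hDY i).2) (fun i => ?_) hX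
    have h1 : 1 ≤ 4 / κ := by rw [le_div_iff₀ hκ]; linarith
    nlinarith [(hDY i).1, (hDY i).2]

end RenewalWeights

/-! ### Abelian estimates for averages and power means -/

namespace RenewalWeights

variable {d p : ℕ → ℝ} {c C : ℝ}

theorem tendsto_sum_atTop (h : RenewalWeights d p c C) :
    Tendsto (fun n => ∑ j ∈ Finset.range n, p j) atTop atTop := by
  rw [tendsto_atTop_atTop]
  intro b
  have hb : 0 < |b| + 1 := by positivity
  obtain ⟨K, _, hK⟩ := h.exists_scale (q := p 0 / (|b| + 1)) (div_pos h.zero_pos hb)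
  refine ⟨K, fun n hn => ?_⟩
  have h1 := hK 1 le_rfl
  rw [Finset.sum_range_one, one_mul, div_mul_eq_mul_div, le_div_iff₀ hb] at h1
  have h2 := le_of_mul_le_mul_left h1 h.zero_pos
  linarith [h.sum_mono hn, le_abs_self b]

theorem tendsto_mul_atTop (h : RenewalWeights d p c C) :
    Tendsto (fun n : ℕ => (n : ℝ) * p n) atTop atTop :=
  tendsto_atTop_mono h.le_mul (h.tendsto_sum_atTop.const_mul_atTop h.lower_pos)

theorem sum_le_of_hasSum (h : RenewalWeights d p c C) {x s : ℝ} (hx0 : 0 ≤ x)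
    (hx1 : x ≤ 1) (hs : HasSum (fun j => p j * x ^ j) s) (n : ℕ) :
    x ^ n * ∑ j ∈ Finset.range n, p j ≤ s := by
  refine le_trans ?_ (sum_le_hasSum (Finset.range n)
    (fun j _ => mul_nonneg (h.pos j).le (pow_nonneg hx0 j)) hs)
  rw [Finset.mul_sum]
  refine Finset.sum_le_sum fun j hj => ?_
  rw [mul_comm]
  exact mul_le_mul_of_nonneg_left
    (pow_le_pow_of_le_one hx0 hx1 (Finset.mem_range.1 hj).le) (h.pos j).le

theorem tendsto_genFun_atTop (h : RenewalWeights d p c C) {f : ℝ → ℝ}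
    (hf : ∀ x, 0 ≤ x → x < 1 → HasSum (fun j => p j * x ^ j) (f x)) :
    Tendsto f (𝓝[<] 1) atTop := by
  rw [tendsto_atTop]
  intro b
  obtain ⟨n, hn⟩ := (h.tendsto_sum_atTop.eventually_ge_atTop (2 * |b|)).exists
  have h1 : Tendsto (fun x : ℝ => x ^ n) (𝓝[<] 1) (𝓝 1) := by
    have : ContinuousAt (fun x : ℝ => x ^ n) 1 := by fun_prop
    have h2 := this.tendsto
    rw [one_pow] at h2
    exact h2.mono_left nhdsWithin_le_nhds
  have h3 : ∀ᶠ x in 𝓝[<] (1 : ℝ), x ∈ Set.Ioo (0 : ℝ) 1 := Ioo_mem_nhdsLT one_pos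
  filter_upwards [h1.eventually (eventually_ge_nhds (by norm_num : (1 / 2 : ℝ) < 1)), h3]
    with x hx hx'
  have h4 := h.sum_le_of_hasSum hx'.1.le hx'.2.le (hf x hx'.1.le hx'.2) n
  have h5 : 1 / 2 * (2 * |b|) ≤ x ^ n * ∑ j ∈ Finset.range n, p j :=
    mul_le_mul hx hn (by positivity) (by linarith)
  linarith [le_abs_self b]

/-- Combined with j p_j ≤ C ∑_{k≤j} p_k, this trades a factor j in a power mean for 1/(1 - x). -/
theorem hasSum_partialSum (h : RenewalWeights d p c C) {x s : ℝ} (hx0 : 0 ≤ x) (hx1 : x < 1)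
    (hs : HasSum (fun j => p j * x ^ j) s) :
    HasSum (fun j => (∑ k ∈ Finset.range (j + 1), p k) * x ^ j) (s * (1 - x)⁻¹) := by
  have hg := hasSum_geometric_of_lt_one hx0 hx1
  have hn1 : Summable fun j => ‖p j * x ^ j‖ :=
    hs.summable.congr fun j => (Real.norm_of_nonneg
      (mul_nonneg (h.pos j).le (pow_nonneg hx0 j))).symm
  have hn2 : Summable fun j => ‖x ^ j‖ :=
    hg.summable.congr fun j => (Real.norm_of_nonneg (pow_nonneg hx0 j)).symm
  have h1 := hasSum_sum_range_mul_of_summable_norm hn1 hn2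
  rw [hs.tsum_eq, hg.tsum_eq] at h1
  refine h1.congr_fun ?_
  intro j
  rw [Finset.sum_mul]
  refine Finset.sum_congr rfl fun k hk => ?_
  rw [mul_assoc, ← pow_add, Nat.add_sub_cancel' (by have := Finset.mem_range.1 hk; omega)]

/-- Convergence of `u` bounds the weighted distance to the limit up to finitely many terms. -/
theorem exists_weighted_bound {u : ℕ → ℂ} {A : ℂ} (h : RenewalWeights d p c C)
    (hu : Tendsto u atTop (𝓝 A)) {ε : ℝ} (hε : 0 < ε) :
    ∃ N : ℕ, ∀ j, p j * ‖u j - A‖ ≤ ε * p j +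
      if j ∈ Finset.range N then p j * ‖u j - A‖ else 0 := by
  rw [Metric.tendsto_atTop] at hu
  obtain ⟨N, hN⟩ := hu ε hε
  refine ⟨N, fun j => ?_⟩
  split_ifs with hj
  · linarith [mul_pos hε (h.pos j)]
  · have h1 := hN j (by simpa using hj)
    rw [dist_eq_norm] at h1
    rw [add_zero, mul_comm]
    exact mul_le_mul_of_nonneg_right h1.le (h.pos j).le

theorem tendsto_average (h : RenewalWeights d p c C) {u : ℕ → ℂ} {A : ℂ}
    (hu : Tendsto u atTop (𝓝 A)) : Tendsto (average d p u) atTop (𝓝 A) := by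
  rw [Metric.tendsto_nhds]
  intro ε hε
  obtain ⟨N, hN⟩ := h.exists_weighted_bound hu (half_pos hε)
  set B := ∑ j ∈ Finset.range N, p j * ‖u j - A‖ with hB
  have hC := h.upper_pos
  have hlim : Tendsto (fun n : ℕ => C * B / (n * p n)) atTop (𝓝 0) :=
    tendsto_const_nhds.div_atTop h.tendsto_mul_atTop
  filter_upwards [hlim.eventually (eventually_lt_nhds (half_pos hε)), eventually_ge_atTop 1]
    with n hn hn1
  have hnp : 0 < (n : ℝ) * p n := mul_pos (by exact_mod_cast hn1) (h.pos n)
  have hB0 : ∀ j, 0 ≤ p j * ‖u j - A‖ := fun j => mul_nonneg (h.pos j).le (norm_nonneg _)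
  have e : average d p u n - A = ∑ j ∈ Finset.range n,
      ((d (n - j) * p j / (n * p n) : ℝ) : ℂ) * (u j - A) := by
    simp_rw [mul_sub]
    rw [Finset.sum_sub_distrib, ← Finset.sum_mul, ← Complex.ofReal_sum, h.sum_jump hn1,
      Complex.ofReal_one, one_mul, average]
  rw [dist_eq_norm, e]
  have h1 : ‖∑ j ∈ Finset.range n, ((d (n - j) * p j / (n * p n) : ℝ) : ℂ) * (u j - A)‖
      ≤ ∑ j ∈ Finset.range n, (ε / 2 * (d (n - j) * p j / (n * p n)) +
        C / (n * p n) * if j ∈ Finset.range N then p j * ‖u j - A‖ else 0) := by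
    refine norm_sum_le_of_le _ fun j hj => ?_
    have hj := Finset.mem_range.1 hj
    rw [norm_mul, Complex.norm_real, Real.norm_of_nonneg (h.jump_nonneg hj)]
    obtain ⟨hd1, hd2⟩ := h.bounds (n - j) (by omega)
    have hd0 := h.lower_pos.le.trans hd1
    have hif : 0 ≤ if j ∈ Finset.range N then p j * ‖u j - A‖ else 0 := by
      split_ifs
      · exact hB0 j
      · exact le_rfl
    calc d (n - j) * p j / (n * p n) * ‖u j - A‖
        = d (n - j) * (p j * ‖u j - A‖) / (n * p n) := by ring
      _ ≤ (d (n - j) * (ε / 2 * p j) + C *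
          if j ∈ Finset.range N then p j * ‖u j - A‖ else 0) / (n * p n) := by
        refine div_le_div_of_nonneg_right ?_ hnp.le
        refine (mul_le_mul_of_nonneg_left (hN j) hd0).trans ?_
        rw [mul_add]
        exact add_le_add le_rfl (mul_le_mul_of_nonneg_right hd2 hif)
      _ = _ := by ring
  rw [Finset.sum_add_distrib, ← Finset.mul_sum, ← Finset.mul_sum, h.sum_jump hn1,
    Finset.sum_ite_mem] at h1
  have h2 : ∑ j ∈ Finset.range n ∩ Finset.range N, p j * ‖u j - A‖ ≤ B :=
    Finset.sum_le_sum_of_subset_of_nonneg Finset.inter_subset_right fun j _ _ => hB0 j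
  have h3 := mul_le_mul_of_nonneg_left h2 (div_nonneg hC.le hnp.le)
  rw [div_mul_eq_mul_div C, div_mul_eq_mul_div C] at h3
  rw [div_mul_eq_mul_div C] at h1
  linarith

/-- Abelian half: weighted power means of a convergent sequence converge to its limit. -/
theorem tendsto_powerMean (h : RenewalWeights d p c C) {u : ℕ → ℂ} {A : ℂ} {f : ℝ → ℝ}
    {g : ℝ → ℂ} (hf : ∀ x, 0 ≤ x → x < 1 → HasSum (fun j => p j * x ^ j) (f x))
    (hg : ∀ x, 0 ≤ x → x < 1 →
      HasSum (fun j => ((p j * x ^ j : ℝ) : ℂ) * u j) ((f x : ℂ) * g x))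
    (hu : Tendsto u atTop (𝓝 A)) : Tendsto g (𝓝[<] 1) (𝓝 A) := by
  rw [Metric.tendsto_nhds]
  intro ε hε
  obtain ⟨N, hN⟩ := h.exists_weighted_bound hu (half_pos hε)
  set B := ∑ j ∈ Finset.range N, p j * ‖u j - A‖ with hB
  have hlim : Tendsto (fun x => B / f x) (𝓝[<] 1) (𝓝 0) :=
    tendsto_const_nhds.div_atTop (h.tendsto_genFun_atTop hf)
  have hIoo : ∀ᶠ x in 𝓝[<] (1 : ℝ), x ∈ Set.Ioo (0 : ℝ) 1 := Ioo_mem_nhdsLT one_pos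
  filter_upwards [hlim.eventually (eventually_lt_nhds (half_pos hε)), hIoo,
    (h.tendsto_genFun_atTop hf).eventually_gt_atTop 0] with x hx hx' hfx
  have hB0 : ∀ j, 0 ≤ p j * ‖u j - A‖ := fun j => mul_nonneg (h.pos j).le (norm_nonneg _)
  have h1 := hf x hx'.1.le hx'.2
  have h2 : HasSum (fun j => ((p j * x ^ j : ℝ) : ℂ) * (u j - A)) ((f x : ℂ) * (g x - A)) := by
    have h3 := (hg x hx'.1.le hx'.2).sub ((Complex.hasSum_ofReal.2 h1).mul_right A)
    rw [← mul_sub] at h3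
    exact h3.congr_fun fun j => mul_sub _ _ _
  have h4 : HasSum (fun j => ε / 2 * (p j * x ^ j) +
      if j ∈ Finset.range N then p j * ‖u j - A‖ else 0) (ε / 2 * f x + B) := by
    refine (h1.mul_left (ε / 2)).add ?_
    have h5 : HasSum (fun j => if j ∈ Finset.range N then p j * ‖u j - A‖ else 0)
        (∑ j ∈ Finset.range N, if j ∈ Finset.range N then p j * ‖u j - A‖ else 0) :=
      hasSum_sum_of_ne_finset_zero fun j hj => if_neg hj
    rwa [Finset.sum_ite_mem, Finset.inter_self] at h5
  have h6 : ‖(f x : ℂ) * (g x - A)‖ ≤ ε / 2 * f x + B := by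
    refine h2.norm_le_of_bounded h4 fun j => ?_
    have hxj : 0 ≤ x ^ j := pow_nonneg hx'.1.le j
    have hxj1 : x ^ j ≤ 1 := pow_le_one₀ hx'.1.le hx'.2.le
    rw [norm_mul, Complex.norm_real, Real.norm_of_nonneg (mul_nonneg (h.pos j).le hxj)]
    have hif : 0 ≤ if j ∈ Finset.range N then p j * ‖u j - A‖ else 0 := by
      split_ifs
      · exact hB0 j
      · exact le_rfl
    calc p j * x ^ j * ‖u j - A‖ = x ^ j * (p j * ‖u j - A‖) := by ring
      _ ≤ x ^ j * (ε / 2 * p j + if j ∈ Finset.range N then p j * ‖u j - A‖ else 0) :=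
        mul_le_mul_of_nonneg_left (hN j) hxj
      _ ≤ _ := by
        rw [mul_add]
        refine add_le_add (le_of_eq (by ring)) ?_
        exact mul_le_of_le_one_left hif hxj1
  rw [norm_mul, Complex.norm_real, Real.norm_of_nonneg hfx.le, mul_comm, ← le_div_iff₀ hfx,
    add_div, mul_div_cancel_right₀ _ hfx.ne'] at h6
  rw [dist_eq_norm]
  linarith

/-! ### Tauberian half -/

/-- Growth of `u` above a block when the oscillation over each later block is at most `δ`. -/
theorem norm_sub_le_mul_div {u : ℕ → ℂ} {K i : ℕ} {δ : ℝ} (hK : 2 ≤ K)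
    (hosc : ∀ r, i ≤ r → ∀ a b, K ^ r ≤ a → a ≤ K ^ (r + 1) → K ^ r ≤ b → b ≤ K ^ (r + 1) →
      ‖u a - u b‖ ≤ δ) {n j : ℕ} (hn : K ^ i ≤ n) (hn' : n ≤ K ^ (i + 1)) (hj : K ^ i ≤ j) :
    ‖u n - u j‖ ≤ δ * (j / (K : ℝ) ^ i) := by
  have hδ : 0 ≤ δ := (norm_nonneg _).trans (hosc i le_rfl n n hn hn' hn hn')
  -- Crossing s further blocks costs (s + 1) δ; afterwards s + 1 ≤ K^s ≤ j / K^i makes this linear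
  -- in j.
  have step : ∀ s j, K ^ i ≤ j → j ≤ K ^ (i + s + 1) → ‖u n - u j‖ ≤ δ * (s + 1) := by
    intro s
    induction s with
    | zero =>
      intro j hj hj'
      simpa using hosc i le_rfl n j hn hn' hj hj'
    | succ s ih =>
      intro j hj hj'
      push_cast
      rcases le_or_gt j (K ^ (i + s + 1)) with hlt | hgt
      · exact (ih j hj hlt).trans (mul_le_mul_of_nonneg_left (by linarith) hδ)
      · have h1 := ih (K ^ (i + s + 1)) (Nat.pow_le_pow_right (by omega) (by omega)) le_rfl
        have h2 := hosc (i + s + 1) (by omega) (K ^ (i + s + 1)) j le_rfl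
          (Nat.pow_le_pow_right (by omega) (by omega)) hgt.le (by rwa [← add_assoc] at hj')
        have h3 := norm_sub_le_norm_sub_add_norm_sub (u n) (u (K ^ (i + s + 1))) (u j)
        linarith
  have hj0 : j ≠ 0 := by
    have : 1 ≤ K ^ i := Nat.one_le_pow _ _ (by omega)
    omega
  have hri : i ≤ Nat.log K j := Nat.le_log_of_pow_le (by omega) hj
  obtain ⟨s, hs⟩ := Nat.exists_eq_add_of_le hri
  have h1 := step s j hj (by rw [← hs]; exact (Nat.lt_pow_succ_log_self (by omega) j).le)
  refine h1.trans (mul_le_mul_of_nonneg_left ?_ hδ)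
  have hKpos : (0 : ℝ) < (K : ℝ) ^ i := by
    have : (0 : ℝ) < K := by exact_mod_cast (by omega : 0 < K)
    positivity
  rw [le_div_iff₀ hKpos]
  have h2 : K ^ (i + s) ≤ j := by rw [← hs]; exact Nat.pow_log_le_self K hj0
  have h3 : s + 1 ≤ K ^ s := Nat.lt_pow_self (by omega)
  have h4 : (s + 1) * K ^ i ≤ j := by
    calc (s + 1) * K ^ i ≤ K ^ s * K ^ i := Nat.mul_le_mul_right _ h3
      _ = K ^ (i + s) := by rw [← pow_add, add_comm]
      _ ≤ j := h2
  exact_mod_cast h4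

/-- At x = L/(L + 1) the powers x^j with j ≤ L stay above 1/e, so p(x) controls the partial sum
below L. -/
theorem exp_neg_one_le_pow (L : ℕ) (hL : 1 ≤ L) :
    Real.exp (-1) ≤ ((L : ℝ) / (L + 1)) ^ L := by
  have hL' : (0 : ℝ) < L := by exact_mod_cast hL
  have h1 : (1 + 1 / (L : ℝ)) ^ L ≤ Real.exp 1 := by
    have h2 : 1 + 1 / (L : ℝ) ≤ Real.exp (1 / L) := by
      linarith [Real.add_one_le_exp (1 / (L : ℝ))]
    calc (1 + 1 / (L : ℝ)) ^ L ≤ Real.exp (1 / L) ^ L := by gcongr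
      _ = Real.exp 1 := by rw [← Real.exp_nat_mul]; congr 1; field_simp
  have h3 : ((L : ℝ) / (L + 1)) ^ L = ((1 + 1 / (L : ℝ)) ^ L)⁻¹ := by
    rw [← inv_pow]
    congr 1
    field_simp
  rw [h3, Real.exp_neg]
  exact inv_anti₀ (by positivity) h1

/-- Tauberian half: an almost harmonic sequence converges once its weighted power means do. -/
theorem tendsto_of_tendsto_powerMean (h : RenewalWeights d p c C) {u : ℕ → ℂ} {A : ℂ} {f : ℝ → ℝ}
    {g : ℝ → ℂ} (hf : ∀ x, 0 ≤ x → x < 1 → HasSum (fun j => p j * x ^ j) (f x))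
    (hg : ∀ x, 0 ≤ x → x < 1 →
      HasSum (fun j => ((p j * x ^ j : ℝ) : ℂ) * u j) ((f x : ℂ) * g x))
    (hu : Tendsto (fun n => u n - average d p u n) atTop (𝓝 0))
    (hgA : Tendsto g (𝓝[<] 1) (𝓝 A)) : Tendsto u atTop (𝓝 A) := by
  have hC := h.upper_pos
  obtain ⟨K, D, Y, φ, hK, hD, hY, hφ0, hφz, hsum, hosc⟩ := h.exists_oscillation_bound hu
  have hKpos : ∀ i, 1 ≤ K ^ i := fun i => Nat.one_le_pow _ _ (by omega)
  have hKR : (0 : ℝ) < K := by exact_mod_cast (by omega : 0 < K)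
  let x : ℕ → ℝ := fun i => ((K ^ (i + 1) : ℕ) : ℝ) / (((K ^ (i + 1) : ℕ) : ℝ) + 1)
  -- The three errors: δ inside the block, 2 K C δ from linear growth above it, and e Y from the
  -- points below it.
  have main : ∀ i δ, (∀ r, i ≤ r → D r ≤ δ) → ∀ n, K ^ i ≤ n → n ≤ K ^ (i + 1) →
      ‖u n - g (x i)‖ ≤ δ * (1 + 2 * K * C) + Real.exp 1 * Y i := by
    intro i δ hδ n hn hn'
    set L := K ^ (i + 1) with hL
    have hL1 : 1 ≤ L := hKpos _
    have hLR : (1 : ℝ) ≤ L := by exact_mod_cast hL1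
    have hx : x i = (L : ℝ) / (L + 1) := rfl
    have hx0 : 0 ≤ x i := by rw [hx]; positivity
    have hx1 : x i < 1 := by rw [hx, div_lt_one (by positivity)]; linarith
    have hblock : ∀ r, i ≤ r → ∀ a b, K ^ r ≤ a → a ≤ K ^ (r + 1) → K ^ r ≤ b →
        b ≤ K ^ (r + 1) → ‖u a - u b‖ ≤ δ := by
      intro r hr a b ha ha' hb hb'
      have h1 := hosc r a b ha' hb'
      rw [hφz r a ha, hφz r b hb] at h1
      linarith [hδ r hr]
    have hδ0 : 0 ≤ δ := (norm_nonneg _).trans (hblock i le_rfl n n hn hn' hn hn')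
    have hpt : ∀ j, ‖u n - u j‖ ≤ δ + δ * (K * (j / L)) + φ i j := by
      intro j
      rcases le_or_gt (K ^ i) j with hj | hj
      · have h1 := norm_sub_le_mul_div hK hblock hn hn' hj
        have h2 : (j : ℝ) / (K : ℝ) ^ i = K * (j / L) := by
          rw [hL]; push_cast; field_simp; ring
        rw [h2] at h1
        linarith [hφ0 i j]
      · have h1 := hosc i n j hn' (hj.le.trans (Nat.pow_le_pow_right (by omega) (Nat.le_succ i)))
        rw [hφz i n hn] at h1
        have h2 : 0 ≤ δ * (K * ((j : ℝ) / L)) := by positivity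
        linarith [hδ i le_rfl]
    have hfx := hf (x i) hx0 hx1
    have hPf : ∑ j ∈ Finset.range L, p j ≤ Real.exp 1 * f (x i) := by
      have h1 := h.sum_le_of_hasSum hx0 hx1.le hfx L
      have h2 := mul_le_mul_of_nonneg_right (exp_neg_one_le_pow L hL1) (h.sum_pos hL1).le
      rw [← hx] at h2
      have h3 := h2.trans h1
      rwa [Real.exp_neg, inv_mul_le_iff₀ (Real.exp_pos 1)] at h3
    have hfpos : 0 < f (x i) :=
      pos_of_mul_pos_right ((h.sum_pos hL1).trans_le hPf) (Real.exp_pos 1).le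
    have h2 : HasSum (fun j => ((p j * x i ^ j : ℝ) : ℂ) * (u n - u j))
        ((f (x i) : ℂ) * (u n - g (x i))) := by
      have h3 := ((Complex.hasSum_ofReal.2 hfx).mul_right (u n)).sub (hg (x i) hx0 hx1)
      rw [← mul_sub] at h3
      exact h3.congr_fun fun j => mul_sub _ _ _
    have hφsum : HasSum (fun j => p j * φ i j) (∑ j ∈ Finset.range L, p j * φ i j) :=
      hasSum_sum_of_ne_finset_zero fun j hj => by
        have hLj : L ≤ j := by simpa using hj
        rw [hφz i j ((Nat.pow_le_pow_right (by omega) (Nat.le_succ i)).trans hLj), mul_zero]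
    have h4 := ((hfx.mul_left δ).add
      ((h.hasSum_partialSum hx0 hx1 hfx).mul_left (δ * (K * (C / L))))).add hφsum
    have h5 := h2.norm_le_of_bounded h4 fun j => by
      have hxj : 0 ≤ x i ^ j := pow_nonneg hx0 j
      have hxj1 : x i ^ j ≤ 1 := pow_le_one₀ hx0 hx1.le
      have hw : 0 ≤ p j * x i ^ j := mul_nonneg (h.pos j).le hxj
      rw [norm_mul, Complex.norm_real, Real.norm_of_nonneg hw]
      refine (mul_le_mul_of_nonneg_left (hpt j) hw).trans ?_
      rw [mul_add, mul_add]
      refine add_le_add (add_le_add (le_of_eq (mul_comm _ _)) ?_) ?_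
      · have h6 : (j : ℝ) * p j ≤ C * ∑ k ∈ Finset.range (j + 1), p k :=
          (h.mul_le j).trans (mul_le_mul_of_nonneg_left (h.sum_mono (Nat.le_succ j)) hC.le)
        calc p j * x i ^ j * (δ * (K * (j / L)))
            = δ * (K * (1 / L)) * x i ^ j * (j * p j) := by ring
          _ ≤ δ * (K * (1 / L)) * x i ^ j * (C * ∑ k ∈ Finset.range (j + 1), p k) :=
            mul_le_mul_of_nonneg_left h6 (by positivity)
          _ = _ := by ring
      · rw [mul_right_comm]
        exact mul_le_of_le_one_right (mul_nonneg (h.pos j).le (hφ0 i j)) hxj1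
    -- Here 1/(1 - x) = L + 1, and (L + 1)/L ≤ 2 accounts for the factor 2.
    have h7 : δ * (K * (C / L)) * (f (x i) * (1 - x i)⁻¹) ≤ δ * (2 * K * C) * f (x i) := by
      have h8 : (1 - x i)⁻¹ = L + 1 := by
        rw [hx]; field_simp; ring
      have h9 : ((L : ℝ) + 1) / L ≤ 2 := by rw [div_le_iff₀ (by linarith)]; linarith
      rw [h8]
      calc δ * (K * (C / L)) * (f (x i) * (L + 1))
          = δ * (K * C) * f (x i) * ((L + 1) / L) := by ring
        _ ≤ δ * (K * C) * f (x i) * 2 := mul_le_mul_of_nonneg_left h9 (by positivity)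
        _ = _ := by ring
    have hY0 : 0 ≤ Y i := by
      have h10 : 0 ≤ ∑ j ∈ Finset.range L, p j * φ i j :=
        Finset.sum_nonneg fun j _ => mul_nonneg (h.pos j).le (hφ0 i j)
      exact nonneg_of_mul_nonneg_right (h10.trans (hsum i)) (h.sum_pos hL1)
    have h11 := (hsum i).trans (mul_le_mul_of_nonneg_right hPf hY0)
    rw [norm_mul, Complex.norm_real, Real.norm_of_nonneg hfpos.le] at h5
    refine le_of_mul_le_mul_left (h5.trans ?_) hfpos
    linarith
  have hxlim : Tendsto x atTop (𝓝[<] 1) := by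
    refine tendsto_nhdsWithin_iff.2 ⟨?_, Eventually.of_forall fun i => ?_⟩
    · have h1 : Tendsto (fun i => K ^ (i + 1)) atTop atTop :=
        (tendsto_pow_atTop_atTop_of_one_lt (by omega : 1 < K)).comp (tendsto_add_atTop_nat 1)
      exact (tendsto_natCast_div_add_atTop (1 : ℝ)).comp h1
    · have h2 : (0 : ℝ) < ((K ^ (i + 1) : ℕ) : ℝ) + 1 := by positivity
      exact (div_lt_one h2).2 (lt_add_one _)
  rw [Metric.tendsto_atTop]
  intro ε hε
  have hE : 0 < 1 + 2 * K * C := by positivity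
  have hδpos : 0 < ε / 4 / (1 + 2 * K * C) := by positivity
  have hYε : 0 < ε / 4 / Real.exp 1 := by positivity
  obtain ⟨i₁, hi₁⟩ := eventually_atTop.1 (hD.eventually (eventually_le_nhds hδpos))
  obtain ⟨i₂, hi₂⟩ := eventually_atTop.1 (hY.eventually (eventually_le_nhds hYε))
  obtain ⟨i₃, hi₃⟩ := Metric.tendsto_atTop.1 (hgA.comp hxlim) (ε / 2) (half_pos hε)
  refine ⟨K ^ (i₁ + i₂ + i₃), fun n hn => ?_⟩
  have hn0 : n ≠ 0 := by have := hKpos (i₁ + i₂ + i₃); omega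
  have hi : i₁ + i₂ + i₃ ≤ Nat.log K n := Nat.le_log_of_pow_le (by omega) hn
  set i := Nat.log K n with hidef
  have h1 := main i (ε / 4 / (1 + 2 * K * C)) (fun r hr => hi₁ r (by omega)) n
    (Nat.pow_log_le_self K hn0) (Nat.lt_pow_succ_log_self (by omega) n).le
  rw [div_mul_cancel₀ _ hE.ne'] at h1
  have h2 := mul_le_mul_of_nonneg_left (hi₂ i (by omega)) (Real.exp_pos 1).le
  rw [mul_div_cancel₀ _ (Real.exp_pos 1).ne'] at h2
  have h3 := hi₃ i (by omega)
  rw [Function.comp_apply, dist_eq_norm] at h3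
  rw [dist_eq_norm]
  have h4 := norm_sub_le_norm_sub_add_norm_sub (u n) (g (x i)) A
  linarith

end RenewalWeights

/-! ### The recursion from the exponential generating function -/

theorem analyticAt_and_iteratedDeriv_of_hasSum {a : ℕ → ℂ} {f : ℂ → ℂ}
    (hf : ∀ z : ℂ, ‖z‖ < 1 → HasSum (fun n => a n * z ^ n) (f z)) :
    AnalyticAt ℂ f 0 ∧ ∀ n : ℕ, iteratedDeriv n f 0 = n.factorial * a n := by
  have h1 : HasFPowerSeriesAt f (FormalMultilinearSeries.ofScalars ℂ a) 0 := by
    rw [hasFPowerSeriesAt_iff]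
    filter_upwards [Metric.ball_mem_nhds (0 : ℂ) one_pos] with z hz
    rw [mem_ball_zero_iff] at hz
    rw [zero_add]
    refine (hf z hz).congr_fun fun n => ?_
    rw [FormalMultilinearSeries.coeff_ofScalars, smul_eq_mul, mul_comm]
  have h2 : AnalyticAt ℂ f 0 := h1.analyticAt
  refine ⟨h2, fun n => ?_⟩
  have h3 := congrArg (fun q => FormalMultilinearSeries.coeff q n)
    (h1.eq_formalMultilinearSeries h2.hasFPowerSeriesAt)
  simp only [FormalMultilinearSeries.coeff_ofScalars] at h3
  rw [h3, mul_div_cancel₀ _ (Nat.cast_ne_zero.2 n.factorial_ne_zero)]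

/-- The coefficients of the exponential of a power series satisfy the logarithmic-derivative
recursion. -/
theorem coeff_exp_recursion {b e : ℕ → ℂ} {f D : ℂ → ℂ}
    (hf : ∀ z : ℂ, ‖z‖ < 1 → HasSum (fun n => b n * z ^ n) (f z))
    (hD : ∀ z : ℂ, ‖z‖ < 1 → HasSum (fun n => e n * z ^ n) (D z))
    (hfD : ∀ z : ℂ, ‖z‖ < 1 → f z = Complex.exp (D z)) (n : ℕ) :
    ((n + 1 : ℕ) : ℂ) * b (n + 1)
      = ∑ k ∈ Finset.range (n + 1), ((k + 1 : ℕ) : ℂ) * e (k + 1) * b (n - k) := by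
  obtain ⟨hfa, hfc⟩ := analyticAt_and_iteratedDeriv_of_hasSum hf
  obtain ⟨hDa, hDc⟩ := analyticAt_and_iteratedDeriv_of_hasSum hD
  have hball : ∀ᶠ z in 𝓝 (0 : ℂ), ‖z‖ < 1 := by
    filter_upwards [Metric.ball_mem_nhds (0 : ℂ) one_pos] with z hz
    rwa [mem_ball_zero_iff] at hz
  have hev : f =ᶠ[𝓝 0] fun z => Complex.exp (D z) := hball.mono hfD
  -- Near 0, f' = D' f; the n-th derivative at 0, expanded by Leibniz, gives the recursion.
  have hder : deriv f =ᶠ[𝓝 0] fun z => deriv D z * f z := by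
    filter_upwards [hev.deriv, hev, hDa.eventually_analyticAt] with z hz hz' hDz
    rw [hz, hz', (hDz.differentiableAt.hasDerivAt.cexp).deriv, mul_comm]
  have h1 := hfc (n + 1)
  rw [iteratedDeriv_succ', Filter.EventuallyEq.iteratedDeriv_eq n hder,
    iteratedDeriv_fun_mul hDa.deriv.contDiffAt hfa.contDiffAt] at h1
  have h2 : ∀ k ∈ Finset.range (n + 1),
      (n.choose k : ℂ) * iteratedDeriv k (deriv D) 0 * iteratedDeriv (n - k) f 0
        = n.factorial * (((k + 1 : ℕ) : ℂ) * e (k + 1) * b (n - k)) := by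
    intro k hk
    have hk : k ≤ n := by have := Finset.mem_range.1 hk; omega
    rw [← iteratedDeriv_succ', hDc, hfc, ← Nat.choose_mul_factorial_mul_factorial hk,
      Nat.factorial_succ]
    push_cast
    ring
  rw [Finset.sum_congr rfl h2, ← Finset.mul_sum, Nat.factorial_succ] at h1
  have h3 : (n.factorial : ℂ) ≠ 0 := Nat.cast_ne_zero.2 n.factorial_ne_zero
  refine mul_left_cancel₀ h3 ?_
  rw [h1]
  push_cast
  ring

theorem renewalWeights_of_hasSum_exp {d p : ℕ → ℝ} {c C : ℝ} (hc : 0 < c)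
    (hd : ∀ k : ℕ, 1 ≤ k → c ≤ d k ∧ d k ≤ C)
    (hp : ∀ z : ℂ, ‖z‖ < 1 →
      HasSum (fun j : ℕ => (p j : ℂ) * z ^ j)
        (Complex.exp (∑' k : ℕ, (d (k + 1) : ℂ) / ((k + 1 : ℕ) : ℂ) * z ^ (k + 1)))) :
    RenewalWeights d p c C := by
  have hD : ∀ z : ℂ, ‖z‖ < 1 → HasSum (fun n : ℕ => (d n : ℂ) / (n : ℂ) * z ^ n)
      (∑' k : ℕ, (d (k + 1) : ℂ) / ((k + 1 : ℕ) : ℂ) * z ^ (k + 1)) := by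
    intro z hz
    -- The term of index 0 vanishes because division by zero gives 0, whatever `d 0` is.
    rw [← hasSum_nat_add_iff' 1]
    simp only [Finset.sum_range_one, Nat.cast_zero, div_zero, zero_mul, sub_zero]
    refine Summable.hasSum ?_
    refine Summable.of_norm_bounded
      (g := fun k => C * ‖z‖ ^ k) ((summable_geometric_of_lt_one (norm_nonneg z) hz).mul_left C)
      fun k => ?_
    obtain ⟨h1, h2⟩ := hd (k + 1) (by omega)
    rw [norm_mul, norm_div, Complex.norm_real, Complex.norm_natCast, norm_pow,
      Real.norm_of_nonneg (hc.le.trans h1)]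
    have hk : (1 : ℝ) ≤ ((k + 1 : ℕ) : ℝ) := by exact_mod_cast Nat.le_add_left 1 k
    have h3 : d (k + 1) / ((k + 1 : ℕ) : ℝ) ≤ C :=
      (div_le_self (hc.le.trans h1) hk).trans h2
    have h4 : ‖z‖ ^ (k + 1) ≤ ‖z‖ ^ k :=
      pow_le_pow_of_le_one (norm_nonneg z) hz.le (Nat.le_succ k)
    exact mul_le_mul h3 h4 (by positivity) (hc.le.trans (h1.trans h2))
  have hp0 : p 0 = 1 := by
    have h1 := hp 0 (by simp)
    have h2 : HasSum (fun j : ℕ => (p j : ℂ) * 0 ^ j) ((p 0 : ℂ) * 0 ^ 0) :=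
      hasSum_single 0 fun j hj => by rw [zero_pow hj, mul_zero]
    have h3 := h2.unique h1
    simp only [pow_zero, mul_one, ne_eq, Nat.add_eq_zero_iff, one_ne_zero, and_false,
      not_false_eq_true, zero_pow, mul_zero, tsum_zero, Complex.exp_zero] at h3
    exact_mod_cast h3
  refine ⟨hc, hd, by rw [hp0]; exact one_pos, fun n => ?_⟩
  cases n with
  | zero => simp
  | succ n =>
    have h1 := coeff_exp_recursion hp hD (fun z _ => rfl) n
    have h2 : ∀ k ∈ Finset.range (n + 1),
        ((k + 1 : ℕ) : ℂ) * ((d (k + 1) : ℂ) / ((k + 1 : ℕ) : ℂ)) * (p (n - k) : ℂ)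
          = ((d (k + 1) * p (n - k) : ℝ) : ℂ) := by
      intro k _
      rw [mul_div_cancel₀ _ (Nat.cast_ne_zero.2 (Nat.succ_ne_zero k))]
      push_cast
      rfl
    rw [Finset.sum_congr rfl h2, ← Complex.ofReal_sum, ← Complex.ofReal_natCast,
      ← Complex.ofReal_mul] at h1
    rw [Complex.ofReal_injective h1,
      ← Finset.sum_range_reflect (fun k => d (k + 1) * p (n - k)) (n + 1)]
    refine Finset.sum_congr rfl fun j hj => ?_
    have hj : j ≤ n := by have := Finset.mem_range.1 hj; omega
    rw [show n + 1 - 1 - j + 1 = n + 1 - j by omega, show n - (n + 1 - 1 - j) = j by omega]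

/-! ### Voronoi means and the equivalence -/

namespace RenewalWeights

variable {d p : ℕ → ℝ} {c C : ℝ}

/-- Split n = k + (n - k) inside the convolution and expand (n - k) p_{n-k} by the recursion. -/
theorem mul_convolution_eq (h : RenewalWeights d p c C) (a : ℕ → ℂ) (n : ℕ) :
    (n : ℂ) * ∑ k ∈ Finset.range (n + 1), a k * (p (n - k) : ℂ)
      = ∑ k ∈ Finset.range (n + 1), a k * (k : ℂ) * (p (n - k) : ℂ)
        + ∑ j ∈ Finset.range n, (d (n - j) : ℂ) *
          ∑ k ∈ Finset.range (j + 1), a k * (p (j - k) : ℂ) := by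
  have h1 : ∑ j ∈ Finset.range n, (d (n - j) : ℂ) *
      ∑ k ∈ Finset.range (j + 1), a k * (p (j - k) : ℂ)
        = ∑ k ∈ Finset.range n, a k * (((n - k : ℕ) : ℂ) * (p (n - k) : ℂ)) := by
    simp_rw [Finset.mul_sum]
    rw [Finset.sum_comm' (t' := Finset.range n) (s' := fun k => Finset.Ico k n)
      (by intro j k; simp only [Finset.mem_range, Finset.mem_Ico]; omega)]
    refine Finset.sum_congr rfl fun k _ => ?_
    have h2 : ((n - k : ℕ) : ℂ) * (p (n - k) : ℂ)
        = ∑ i ∈ Finset.range (n - k), (d (n - k - i) : ℂ) * (p i : ℂ) := by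
      have h3 := congrArg (fun x : ℝ => (x : ℂ)) (h.recursion (n - k))
      simpa only [Complex.ofReal_mul, Complex.ofReal_natCast, Complex.ofReal_sum] using h3
    rw [h2, Finset.mul_sum, Finset.sum_Ico_eq_sum_range]
    refine Finset.sum_congr rfl fun i _ => ?_
    rw [Nat.sub_sub, Nat.add_sub_cancel_left]
    ring
  rw [h1, Finset.mul_sum]
  have h4 : ∑ k ∈ Finset.range n, a k * (((n - k : ℕ) : ℂ) * (p (n - k) : ℂ))
      = ∑ k ∈ Finset.range (n + 1), a k * (((n - k : ℕ) : ℂ) * (p (n - k) : ℂ)) := by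
    rw [Finset.sum_range_succ]
    simp
  rw [h4, ← Finset.sum_add_distrib]
  refine Finset.sum_congr rfl fun k hk => ?_
  have hk : k ≤ n := by have := Finset.mem_range.1 hk; omega
  rw [Nat.cast_sub hk]
  ring

/-- The defect of harmonicity of the Voronoi means of `a`. -/
theorem voronoiMean_sub_average (h : RenewalWeights d p c C) (a : ℕ → ℂ) {n : ℕ} (hn : 1 ≤ n) :
    (1 / (p n : ℂ)) * ∑ k ∈ Finset.range (n + 1), a k * (p (n - k) : ℂ)
      - average d p (fun n => (1 / (p n : ℂ)) *
        ∑ k ∈ Finset.range (n + 1), a k * (p (n - k) : ℂ)) n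
      = (∑ k ∈ Finset.range (n + 1), a k * (k : ℂ) * (p (n - k) : ℂ)) /
        ((n * p n : ℝ) : ℂ) := by
  have hpn : ∀ j, (p j : ℂ) ≠ 0 := fun j => Complex.ofReal_ne_zero.2 (h.pos j).ne'
  have hn0 : (n : ℂ) ≠ 0 := Nat.cast_ne_zero.2 (by omega)
  have h1 : average d p (fun n => (1 / (p n : ℂ)) *
      ∑ k ∈ Finset.range (n + 1), a k * (p (n - k) : ℂ)) n
        = (∑ j ∈ Finset.range n, (d (n - j) : ℂ) *
          ∑ k ∈ Finset.range (j + 1), a k * (p (j - k) : ℂ)) / ((n : ℂ) * (p n : ℂ)) := by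
    rw [average, Finset.sum_div]
    refine Finset.sum_congr rfl fun j _ => ?_
    have := hpn j
    have := hpn n
    push_cast
    field_simp
  have h2 := h.mul_convolution_eq a n
  have := hpn n
  rw [h1]
  push_cast
  rw [eq_div_iff (mul_ne_zero hn0 this), sub_mul, div_mul_cancel₀ _ (mul_ne_zero hn0 this),
    sub_eq_iff_eq_add, ← h2]
  field_simp

end RenewalWeights

theorem theorem2 (a : ℕ → ℂ) (g : ℂ → ℂ)
    (hg : ∀ z : ℂ, ‖z‖ < 1 → HasSum (fun n : ℕ => a n * z ^ n) (g z))
    (d p : ℕ → ℝ) (dminus dplus : ℝ) (hdminus : 0 < dminus)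
    (hd : ∀ k : ℕ, 1 ≤ k → dminus ≤ d k ∧ d k ≤ dplus)
    (hp : ∀ z : ℂ, ‖z‖ < 1 →
      HasSum (fun j : ℕ => (p j : ℂ) * z ^ j)
        (Complex.exp (∑' k : ℕ, (d (k + 1) : ℂ) / ((k + 1 : ℕ) : ℂ) * z ^ (k + 1))))
    (A : ℂ) :
    Tendsto
        (fun n : ℕ => (1 / (p n : ℂ)) * ∑ k ∈ Finset.range (n + 1), a k * (p (n - k) : ℂ))
        atTop (𝓝 A) ↔
      Tendsto (fun x : ℝ => g (x : ℂ)) (𝓝[<] (1 : ℝ)) (𝓝 A) ∧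
      (fun n : ℕ => ∑ k ∈ Finset.range (n + 1), a k * (k : ℂ) * (p (n - k) : ℂ))
        =o[atTop] (fun n : ℕ => (n : ℝ) * p n) := by
  have h := renewalWeights_of_hasSum_exp hdminus hd hp
  set u : ℕ → ℂ := fun n =>
    (1 / (p n : ℂ)) * ∑ k ∈ Finset.range (n + 1), a k * (p (n - k) : ℂ) with hu
  have hnorm : ∀ x : ℝ, 0 ≤ x → x < 1 → ‖(x : ℂ)‖ < 1 := fun x hx0 hx1 => by
    rwa [Complex.norm_real, Real.norm_of_nonneg hx0]
  have hcast : ∀ x : ℝ, ∀ j, ((p j * x ^ j : ℝ) : ℂ) = (p j : ℂ) * (x : ℂ) ^ j :=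
    fun x j => by push_cast; rfl
  have hf : ∀ x : ℝ, 0 ≤ x → x < 1 →
      HasSum (fun j => p j * x ^ j) (∑' j, p j * x ^ j) := fun x hx0 hx1 =>
    (Complex.summable_ofReal.1
      ((hp x (hnorm x hx0 hx1)).summable.congr fun j => (hcast x j).symm)).hasSum
  have hmean : ∀ x : ℝ, 0 ≤ x → x < 1 → HasSum (fun j => ((p j * x ^ j : ℝ) : ℂ) * u j)
      (((∑' j, p j * x ^ j : ℝ) : ℂ) * g (x : ℂ)) := by
    intro x hx0 hx1
    have hgx := hg x (hnorm x hx0 hx1)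
    have hpx := Complex.hasSum_ofReal.2 (hf x hx0 hx1)
    -- The Cauchy product of g and p has coefficients p_n u_n, so g is the power mean of `u`.
    have h1 := hasSum_sum_range_mul_of_summable_norm hgx.summable.norm hpx.summable.norm
    rw [hgx.tsum_eq, hpx.tsum_eq, mul_comm] at h1
    refine h1.congr_fun fun n => ?_
    have hpn : (p n : ℂ) ≠ 0 := Complex.ofReal_ne_zero.2 (h.pos n).ne'
    have h2 : ((p n * x ^ n : ℝ) : ℂ) * u n
        = (x : ℂ) ^ n * ∑ k ∈ Finset.range (n + 1), a k * (p (n - k) : ℂ) := by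
      rw [hcast, hu]
      field_simp
    rw [h2, Finset.mul_sum]
    refine Finset.sum_congr rfl fun k hk => ?_
    have hk : k ≤ n := by have := Finset.mem_range.1 hk; omega
    rw [hcast, ← Nat.add_sub_cancel' hk, pow_add, Nat.add_sub_cancel' hk]
    ring
  have hlittle : (fun n : ℕ => ∑ k ∈ Finset.range (n + 1), a k * (k : ℂ) * (p (n - k) : ℂ))
        =o[atTop] (fun n : ℕ => (n : ℝ) * p n) ↔
      Tendsto (fun n => u n - RenewalWeights.average d p u n) atTop (𝓝 0) := by
    rw [← Complex.isLittleO_ofReal_right, isLittleO_iff_tendsto']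
    · refine tendsto_congr' ?_
      filter_upwards [eventually_ge_atTop 1] with n hn
      exact (h.voronoiMean_sub_average a hn).symm
    · filter_upwards [eventually_ge_atTop 1] with n hn h0
      have hn' : (0 : ℝ) < n := by exact_mod_cast hn
      exact absurd h0 (Complex.ofReal_ne_zero.2 (mul_pos hn' (h.pos n)).ne')
  rw [hlittle]
  constructor
  · intro hA
    refine ⟨h.tendsto_powerMean hf hmean hA, ?_⟩
    simpa using hA.sub (h.tendsto_average hA)
  · rintro ⟨hgA, hdefect⟩
    exact h.tendsto_of_tendsto_powerMean hf hmean hdefect hgA
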